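/- Let $k$ be an algebraically closed field of arbitrary characteristic; varieties are algebraic varieties over $k$ (reduced, separated, of finite type, not necessarily irreducible), and points are closed points, i.e. $k$-points. Let $X$ be an irreducible variety and $\mathrm{Aut}(X)$ its group of automorphisms over $k$. A *family* $\{\varphi_t\}_{t\in T}$ in $\mathrm{Aut}(X)$ is a map $T\to\mathrm{Aut}(X)$, $t\mapsto\varphi_t$, where $T$ is an irreducible variety; put $\varphi_T=\{\varphi_t\mid t\in T\}$. It is *unital* if $\mathrm{id}_X\in\varphi_T$, and *algebraic* if $T\times X\to X$, $(t,x)\mapsto\varphi_t(x)$, is a morphism. Its *inverse* is $\{\varphi_t^{-1}\}_{t\in T}$. The *product* of a finite (nonempty) sequence of families $\{\varphi_t\}_{t\in T},\dots,\{\psi_s\}_{s\in S}$ is the family $\{\varphi_t\circ\cdots\circ\psi_s\}_{(t,\dots,s)\in T\times\cdots\times S}$. A family is *derived* from a collection $\mathcal I$ of families if it is a product of families each of which is a member of $\mathcal I$ or the inverse of a member of $\mathcal I$. The group *generated* by a nonempty collection $\mathcal I$ is the subgroup of $\mathrm{Aut}(X)$ generated by $\bigcup\varphi_T$, the union being over all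 $\{\varphi_t\}_{t\in T}$ in $\mathcal I$. **Theorem.** Let $\mathcal I$ be a nonempty collection of unital algebraic families in $\mathrm{Aut}(X)$, let $G\subseteq\mathrm{Aut}(X)$ be the subgroup generated by $\mathcal I$, and let $Y$ be a $G$-invariant locally closed subvariety of $X$. Then there is a family $\{\varphi_t\}_{t\in T}$ derived from $\mathcal I$ that is exhaustive for the natural action of $G$ on $Y$, that is, $\varphi_T\subseteq G$ and $$G(y)=\{\varphi_t(y)\mid t\in T\}\quad\text{for every point } y\in Y.$$ -/

import Mathlib

open CategoryTheory AlgebraicGeometry Limits MonoidalCategory CartesianMonoidalCategory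

open scoped TensorProduct

universe u

namespace AutFamilies

/-! ## Products of varieties over an algebraically closed field -/

theorem isReduced_tensorProduct (k A B : Type*) [Field k] [IsAlgClosed k] [CommRing A] [CommRing B]
    [Algebra k A] [Algebra k B] [Algebra.FiniteType k A] [IsReduced A] [IsReduced B] :
    IsReduced (A ⊗[k] B) := by
  let b := Module.Basis.ofVectorSpace k B
  let bA := Algebra.TensorProduct.basis A b
  refine ⟨fun u hu => bA.ext_elem fun i => ?_⟩
  have hjac : IsJacobsonRing A := isJacobsonRing_of_finiteType (A := k)
  have hbot : (⊥ : Ideal A).jacobson = ⊥ :=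
    hjac.out (Ideal.isRadical_iff_quotient_reduced _ |>.2
      (isReduced_of_injective _ (RingEquiv.quotientBot A).injective))
  rw [map_zero, Finsupp.coe_zero, Pi.zero_apply, ← Ideal.mem_bot, ← hbot, Ideal.jacobson,
    Submodule.mem_sInf]
  rintro m ⟨-, hm⟩
  let _ := Ideal.Quotient.field m
  have : Module.Finite k (A ⧸ m) := finite_of_finite_type_of_isJacobsonRing k (A ⧸ m)
  have hbij := IsAlgClosed.algebraMap_bijective_of_isIntegral (k := k) (K := A ⧸ m)
  let e : k ≃ₐ[k] A ⧸ m := AlgEquiv.ofBijective (Algebra.ofId k (A ⧸ m)) hbij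
  let f : A →ₐ[k] k := e.symm.toAlgHom.comp (Ideal.Quotient.mkₐ k m)
  let φ : A ⊗[k] B →ₐ[k] B :=
    Algebra.TensorProduct.lift ((Algebra.ofId k B).comp f) (AlgHom.id k B) fun _ _ => .all _ _
  have hφ : φ u = 0 := (hu.map φ).eq_zero
  have hrep : φ u = (bA.repr u).sum fun i a => f a • b i := by
    conv_lhs => rw [← bA.linearCombination_repr u]
    rw [Finsupp.linearCombination_apply, Finsupp.sum, map_sum, Finsupp.sum]
    refine Finset.sum_congr rfl fun j _ => ?_
    simp [bA, φ, Algebra.TensorProduct.basis_apply, Algebra.smul_def,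
      Algebra.ofId_apply]
  have hc : f (bA.repr u i) = 0 := by
    have h2 : b.repr (φ u) i = f (bA.repr u i) := by
      have h3 : b.repr (φ u) = (bA.repr u).mapRange f (map_zero f) := by
        rw [hrep, Finsupp.sum, map_sum]
        refine Finsupp.ext fun j => ?_
        rw [Finsupp.finsetSum_apply, Finsupp.mapRange_apply,
          Finset.sum_eq_single j (fun l _ hl => by simp [Finsupp.single_eq_of_ne' hl])
            (fun h => by simp [Finsupp.notMem_support_iff.1 h])]
        simp
      rw [h3, Finsupp.mapRange_apply]
    rw [← h2, hφ, map_zero, Finsupp.zero_apply]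
  have : Ideal.Quotient.mk m (bA.repr u i) = 0 := by
    simpa [f] using hc
  exact Ideal.Quotient.eq_zero_iff_mem.1 this

section Products

variable {k : Type u} [Field k] [IsAlgClosed k]

theorem isReduced_pullback_spec {A B : CommRingCat.{u}} (f : Spec A ⟶ Spec (.of k))
    (g : Spec B ⟶ Spec (.of k)) [LocallyOfFiniteType f] [IsReduced (Spec A)] [IsReduced (Spec B)] :
    IsReduced (pullback f g) := by
  obtain ⟨f, rfl⟩ := Spec.map_surjective f
  obtain ⟨g, rfl⟩ := Spec.map_surjective g
  let _ : Algebra k A := f.hom.toAlgebra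
  let _ : Algebra k B := g.hom.toAlgebra
  have hft : f.hom.FiniteType :=
    (HasRingHomProperty.Spec_iff (P := @LocallyOfFiniteType)).1 ‹_›
  have : Algebra.FiniteType k A := hft
  have : _root_.IsReduced A := (affine_isReduced_iff A).1 inferInstance
  have : _root_.IsReduced B := (affine_isReduced_iff B).1 inferInstance
  have : _root_.IsReduced (A ⊗[k] B) := isReduced_tensorProduct k A B
  have : IsReduced (Spec (.of (A ⊗[k] B))) := inferInstance
  exact isReduced_of_isOpenImmersion (pullbackSpecIso k A B).hom

theorem isReduced_pullback {T S : Scheme.{u}} (f : T ⟶ Spec (.of k)) (g : S ⟶ Spec (.of k))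
    [LocallyOfFiniteType f] [IsReduced T] [IsReduced S] : IsReduced (pullback f g) := by
  have (i : T.affineOpenCover.openCover.I₀) : LocallyOfFiniteType (T.affineOpenCover.f i ≫ f) :=
    inferInstanceAs (LocallyOfFiniteType (T.affineOpenCover.openCover.f i ≫ f))
  have (i : T.affineOpenCover.openCover.I₀) : IsReduced (Spec (T.affineOpenCover.X i)) :=
    inferInstanceAs (IsReduced (T.affineOpenCover.openCover.X i))
  have (i : S.affineOpenCover.openCover.I₀) : IsReduced (Spec (S.affineOpenCover.X i)) :=
    inferInstanceAs (IsReduced (S.affineOpenCover.openCover.X i))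
  have := fun ij : T.affineOpenCover.openCover.I₀ × S.affineOpenCover.openCover.I₀ =>
    isReduced_pullback_spec (T.affineOpenCover.f ij.1 ≫ f) (S.affineOpenCover.f ij.2 ≫ g)
  exact @IsReduced.of_openCover _ (Scheme.Pullback.openCoverOfLeftRight
    T.affineOpenCover.openCover S.affineOpenCover.openCover f g) this

theorem irreducibleSpace_pullback {T S : Scheme.{u}} (f : T ⟶ Spec (.of k)) (g : S ⟶ Spec (.of k))
    [LocallyOfFiniteType f] [IrreducibleSpace T] [IrreducibleSpace S] :
    IrreducibleSpace ↥(pullback f g) := by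
  have hJ : JacobsonSpace T := LocallyOfFiniteType.jacobsonSpace (Y := Spec _) f
  have hop : IsOpenMap (pullback.fst f g) := (pullback.fst f g).isOpenMap
  have hsurj : Function.Surjective (pullback.fst f g) := by
    rw [← Set.range_eq_univ, Scheme.Pullback.range_fst, Set.eq_univ_iff_forall]
    intro t
    obtain ⟨s⟩ := (inferInstance : Nonempty S)
    exact ⟨s, Subsingleton.elim (α := PrimeSpectrum k) _ _⟩
  have hne : Nonempty ↥(pullback f g) := by
    obtain ⟨t⟩ := (inferInstance : Nonempty T)
    exact ⟨(hsurj t).choose⟩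
  have hpre : PreirreducibleSpace ↥(pullback f g) := by
    refine ⟨?_⟩
    rintro U V hU hV ⟨u, -, hu⟩ ⟨v, -, hv⟩
    obtain ⟨t, ⟨⟨u', hu', hut⟩, ⟨v', hv', hvt⟩⟩, ht⟩ := nonempty_inter_closedPoints
      (nonempty_preirreducible_inter (hop U hU) (hop V hV) ⟨_, u, hu, rfl⟩ ⟨_, v, hv, rfl⟩)
      ((hop U hU).inter (hop V hV)).isLocallyClosed
    let p := pointOfClosedPoint f t ht
    have hp : p ≫ f = 𝟙 _ := pointOfClosedPoint_comp f t ht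
    let σ : S ⟶ pullback f g := pullback.lift (g ≫ p) (𝟙 S) (by simp [hp])
    have hσ : ∀ w : ↥(pullback f g), pullback.fst f g w = t → w ∈ Set.range σ := by
      intro w hw
      have hpb : IsPullback σ g (pullback.fst f g) p := by
        refine IsPullback.of_right (h₁₂ := pullback.snd f g) (h₂₂ := f) (v₁₃ := g) ?_
          (pullback.lift_fst _ _ _) (IsPullback.of_hasPullback f g).flip
        rw [hp, show σ ≫ pullback.snd f g = 𝟙 S from pullback.lift_snd _ _ _]
        exact IsPullback.of_horiz_isIso ⟨by simp⟩
      have hr : w ∈ Set.range (pullback.fst (pullback.fst f g) p) := by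
        rw [Scheme.Pullback.range_fst]
        exact ⟨IsLocalRing.closedPoint k, by rw [hw]; exact pointOfClosedPoint_apply f t ht _⟩
      obtain ⟨z, rfl⟩ := hr
      refine ⟨hpb.isoPullback.inv z, ?_⟩
      rw [← Scheme.Hom.comp_apply, hpb.isoPullback_inv_fst]
    obtain ⟨a, ha⟩ := hσ u' hut
    obtain ⟨b, hb⟩ := hσ v' hvt
    obtain ⟨c, hc, hc'⟩ := nonempty_preirreducible_inter (hU.preimage σ.continuous)
      (hV.preimage σ.continuous) ⟨a, by simpa [ha] using hu'⟩ ⟨b, by simpa [hb] using hv'⟩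
    exact ⟨σ c, trivial, hc, hc'⟩
  exact ⟨hne⟩

end Products

/-! ## Varieties and their points -/

section Definitions

variable {k : Type u} [Field k]

/-- A variety over `k` (used for `k` algebraically closed): a reduced separated `k`-scheme of
finite type. -/
class IsVariety (X : Over (Spec (.of k))) : Prop where
  isReduced : IsReduced X.left
  isSeparated : IsSeparated X.hom
  locallyOfFiniteType : LocallyOfFiniteType X.hom
  quasiCompact : QuasiCompact X.hom

attribute [instance] IsVariety.isReduced IsVariety.isSeparated IsVariety.locallyOfFiniteType
  IsVariety.quasiCompact

/-- The product of two varieties is a variety. -/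
theorem isVariety_tensorObj [IsAlgClosed k] {T S : Over (Spec (.of k))} (hT : IsVariety T)
    (hS : IsVariety S) : IsVariety (T ⊗ S) where
  isReduced := isReduced_pullback T.hom S.hom
  isSeparated := inferInstanceAs (IsSeparated (pullback.fst T.hom S.hom ≫ T.hom))
  locallyOfFiniteType := inferInstanceAs (LocallyOfFiniteType (pullback.fst T.hom S.hom ≫ T.hom))
  quasiCompact := inferInstanceAs (QuasiCompact (pullback.fst T.hom S.hom ≫ T.hom))

/-- The product of two irreducible varieties is irreducible. -/
theorem irreducibleSpace_tensorObj [IsAlgClosed k] {T S : Over (Spec (.of k))} (hT : IsVariety T)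
    (hT' : IrreducibleSpace T.left) (hS' : IrreducibleSpace S.left) :
    IrreducibleSpace (T ⊗ S).left :=
  irreducibleSpace_pullback T.hom S.hom

/-- The points of a variety in the classical sense: its `k`-points, which for `k` algebraically
closed are the same as the closed points of the scheme. -/
abbrev Pt (X : Over (Spec (.of k))) : Type u := Over.mk (𝟙 (Spec (.of k))) ⟶ X

/-- The point of the underlying scheme given by a `k`-point. -/
noncomputable def Pt.toPoint {X : Over (Spec (.of k))} (x : Pt X) : X.left :=
  x.left (IsLocalRing.closedPoint k)

/-- The Zariski topology on the set of `k`-points. -/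
noncomputable instance Pt.instTopologicalSpace (X : Over (Spec (.of k))) : TopologicalSpace (Pt X) :=
  TopologicalSpace.induced Pt.toPoint inferInstance

/-- The natural action of `Aut(X)` (automorphisms over `k`, with `g * h = g ∘ h`) on the points of
`X`: `g • x = g(x)`. -/
noncomputable instance Pt.instMulAction (X : Over (Spec (.of k))) : MulAction (Aut X) (Pt X) where
  smul g x := x ≫ g.hom
  one_smul x := Category.comp_id x
  mul_smul g h x := (Category.assoc x h.hom g.hom).symm

/-! ## Families of automorphisms -/

/-- A family `{φ_t}_{t ∈ T}` in `Aut(X)` parameterized by an irreducible variety `T`: an arbitrary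
map from the points of `T` to `Aut(X)`. -/
structure Family (X : Over (Spec (.of k))) where
  T : Over (Spec (.of k))
  isVariety : IsVariety T
  irreducible : IrreducibleSpace T.left
  φ : Pt T → Aut X

namespace Family

variable {X : Over (Spec (.of k))}

/-- The family is unital: it contains the identity. -/
def IsUnital (F : Family X) : Prop := 1 ∈ Set.range F.φ

/-- The family is algebraic: `T × X → X`, `(t, x) ↦ φ_t(x)`, is a morphism of varieties. -/
def IsAlgebraic (F : Family X) : Prop :=
  ∃ Φ : F.T ⊗ X ⟶ X, ∀ (t : Pt F.T) (x : Pt X), lift t x ≫ Φ = F.φ t • x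

/-- The inverse family `{φ_t⁻¹}_{t ∈ T}`. -/
noncomputable def inverse (F : Family X) : Family X where
  T := F.T
  isVariety := F.isVariety
  irreducible := F.irreducible
  φ t := (F.φ t)⁻¹

/-- The subgroup of `Aut(X)` generated by a collection of families. -/
noncomputable def generatedGroup (I : Set (Family X)) : Subgroup (Aut X) :=
  Subgroup.closure (⋃ F ∈ I, Set.range F.φ)

/-- `F` is a family in `G` that is exhaustive for the natural action of `G` on `Y`:
`G(y) = φ_T(y)` for every `y ∈ Y`. -/
def IsExhaustive (G : Subgroup (Aut X)) (Y : Set (Pt X)) (F : Family X) : Prop :=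
  (∀ t, F.φ t ∈ G) ∧
    ∀ y ∈ Y, MulAction.orbit G y = (fun g : Aut X => g • y) '' Set.range F.φ

variable [IsAlgClosed k]

/-- The product `{φ_t ∘ ψ_s}_{(t, s) ∈ T × S}` of two families. -/
noncomputable def prod (F F' : Family X) : Family X where
  T := F.T ⊗ F'.T
  isVariety := isVariety_tensorObj F.isVariety F'.isVariety
  irreducible := irreducibleSpace_tensorObj F.isVariety F.irreducible F'.irreducible
  φ p := F.φ (p ≫ fst F.T F'.T) * F'.φ (p ≫ snd F.T F'.T)

/-- The product `{φ_t ∘ ⋯ ∘ ψ_s}_{(t, …, s) ∈ T × ⋯ × S}` of the finite sequence of families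
consisting of `F` followed by the members of a list. -/
noncomputable def seqProd : Family X → List (Family X) → Family X
  | F, [] => F
  | F, F' :: l => F.prod (seqProd F' l)

/-- A family is derived from `I` if it is a product of a (nonempty) finite sequence of families
each of which is a member of `I` or the inverse of a member of `I`. -/
def IsDerivedFrom (I : Set (Family X)) (F : Family X) : Prop :=
  ∃ (F₀ : Family X) (l : List (Family X)),
    (∀ H ∈ F₀ :: l, H ∈ I ∨ ∃ H' ∈ I, H = H'.inverse) ∧ F = seqProd F₀ l

end Family

end Definitions

end AutFamilies

namespace AutFamilies

open Topology TopologicalSpace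

/-! ## Topological preliminaries -/

/-! Let `U` be an irreducible, relatively open part of `Y`. For a product `F` of members of `I`, the
pairs `(x, φ_t(x))` with `x ∈ U` form an irreducible subset `graphOn U F` of `X × X`. Since all
families are unital, the product of two families contains both, so a maximal closure `Z` of such
graphs contains every one of them. A generator of `G` acting on the second factor maps `Z` into
itself, hence onto itself because the space is Noetherian (`preimage_eq_of_mapsTo`). So `Z` is
`G`-stable and contains `(x, g(x))` for all `x ∈ U`, `g ∈ G`.

By Chevalley's theorem (`Pt.exists_isOpen_closure_inter_subset_image`) the maximal graph contains a
nonempty open part `Z ∩ V` of `Z`. Finitely many `G`-translates of `V` cover all of them, and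
finitely many group elements lie in one product of families. This exhausts the orbits through a
nonempty open part of `Y` (`exists_exhausting_on_open`). Noetherian induction on the closed
remainder, again with finitely many translates, gives all of `Y` (`exists_exhausting`). -/

/-- A constructible set either contains or misses a nonempty open part of an irreducible set. -/
theorem exists_isOpen_inter_subset_or_subset_compl {α : Type*} [TopologicalSpace α]
    {s Z : Set α} (hs : IsConstructible s) (hZ : IsIrreducible Z) :
    ∃ V : Set α, IsOpen V ∧ (Z ∩ V).Nonempty ∧ (Z ∩ V ⊆ s ∨ Z ∩ V ⊆ sᶜ) := by
  induction hs using IsConstructible.empty_union_induction with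
  | open_retrocompact U hU _ =>
    rcases (Z ∩ U).eq_empty_or_nonempty with h | h
    · refine ⟨Set.univ, isOpen_univ, by simpa using hZ.1, Or.inr ?_⟩
      rw [Set.inter_univ, Set.subset_compl_iff_disjoint_right, Set.disjoint_iff_inter_eq_empty, h]
    · exact ⟨U, hU, h, Or.inl Set.inter_subset_right⟩
  | union s _ t _ hs ht =>
    obtain ⟨V, hV, hVn, hs | hs⟩ := hs
    · exact ⟨V, hV, hVn, Or.inl (hs.trans Set.subset_union_left)⟩
    obtain ⟨V', hV', hVn', ht | ht⟩ := ht
    · exact ⟨V', hV', hVn', Or.inl (ht.trans Set.subset_union_right)⟩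
    -- Irreducibility of `Z` makes the two open sets meet inside `Z`.
    refine ⟨V ∩ V', hV.inter hV', hZ.2 V V' hV hV' hVn hVn', Or.inr ?_⟩
    rw [Set.compl_union]
    exact fun x hx => ⟨hs ⟨hx.1, hx.2.1⟩, ht ⟨hx.1, hx.2.2⟩⟩
  | compl s _ hs =>
    obtain ⟨V, hV, hVn, h⟩ := hs
    exact ⟨V, hV, hVn, by rw [compl_compl]; exact h.symm⟩

/-- A nonempty subset of a Noetherian space has a relatively open irreducible subset. -/
theorem exists_isOpen_isIrreducible_inter {α : Type*} [TopologicalSpace α] [NoetherianSpace α]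
    {Y : Set α} (hY : Y.Nonempty) : ∃ V : Set α, IsOpen V ∧ IsIrreducible (Y ∩ V) := by
  obtain ⟨y, hy⟩ := hY
  let Z : Set Y := irreducibleComponent ⟨y, hy⟩
  obtain ⟨o, ho, hne, hoZ⟩ :=
    NoetherianSpace.exists_isOpen_nonempty_subset_irreducibleComponent Z
      (irreducibleComponent_mem_irreducibleComponents _)
  obtain ⟨V, hV, rfl⟩ := isOpen_induced_iff.1 ho
  have hirr : IsIrreducible ((↑) ⁻¹' V : Set Y) := by
    refine ⟨hne, fun A B hA hB hA' hB' => ?_⟩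
    have hZ : IsPreirreducible Z := isIrreducible_irreducibleComponent.2
    obtain ⟨x, -, hx⟩ := hZ _ _ (hA.inter ho) (hB.inter ho)
      (hA'.imp fun x hx => ⟨hoZ hx.1, hx.2, hx.1⟩) (hB'.imp fun x hx => ⟨hoZ hx.1, hx.2, hx.1⟩)
    exact ⟨x, hx.1.2, hx.1.1, hx.2.1⟩
  refine ⟨V, hV, ?_⟩
  rw [← Subtype.image_preimage_coe]
  exact hirr.image _ continuous_subtype_val.continuousOn

/-- A homeomorphism of a Noetherian space mapping a closed set into itself maps it onto itself. -/
theorem preimage_eq_of_mapsTo {α : Type*} [TopologicalSpace α] [NoetherianSpace α]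
    (a : α ≃ₜ α) {Z : Set α} (hZ : IsClosed Z) (h : Set.MapsTo a Z Z) : a ⁻¹' Z = Z := by
  -- `C n` is `a^n(Z)`, a descending chain of closed sets, so it stabilizes.
  let C : ℕ → Closeds α := fun n => ⟨(a.symm)^[n] ⁻¹' Z, hZ.preimage (a.symm.continuous.iterate n)⟩
  have hC : Antitone C := antitone_nat_of_succ_le fun n x hx => by
    change a.symm^[n] x ∈ Z
    have : a (a.symm^[n + 1] x) ∈ Z := h hx
    rwa [Function.iterate_succ_apply', a.apply_symm_apply] at this
  obtain ⟨_, ⟨n, rfl⟩, hn⟩ := (wellFounded_lt (α := Closeds α)).has_min _ (Set.range_nonempty C)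
  have hn1 : C n = C (n + 1) :=
    ((hC n.le_succ).eq_of_not_lt (hn _ ⟨n + 1, rfl⟩)).symm
  refine Set.Subset.antisymm (fun x hx => ?_) h
  have hmem : a^[n + 1] x ∈ C n := by
    change a.symm^[n] (a^[n + 1] x) ∈ Z
    rw [Function.iterate_succ_apply, (Function.LeftInverse.iterate a.symm_apply_apply n)]
    exact hx
  have hmem' : a^[n + 1] x ∈ C (n + 1) := by
    rwa [hn1] at hmem
  change a.symm^[n + 1] (a^[n + 1] x) ∈ Z at hmem'
  rwa [(Function.LeftInverse.iterate a.symm_apply_apply (n + 1))] at hmem'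

/-- The image of a product of irreducible sets under a separately continuous map is
irreducible. -/
theorem isIrreducible_image2_of_separately_continuous {α β γ : Type*} [TopologicalSpace α]
    [TopologicalSpace β] [TopologicalSpace γ] {A : Set α} {B : Set β} (hA : IsIrreducible A)
    (hB : IsIrreducible B) (f : α → β → γ) (hf : ∀ b, Continuous fun a => f a b)
    (hf' : ∀ a, Continuous (f a)) : IsIrreducible (Set.image2 f A B) := by
  refine ⟨hA.1.image2 hB.1, ?_⟩
  rintro U V hU hV ⟨_, ⟨a, ha, b, hb, rfl⟩, hab⟩ ⟨_, ⟨a', ha', b', hb', rfl⟩, hab'⟩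
  -- Move one variable at a time: first find a common `c` for the fixed `a`, `a'`, then a common `d`
  -- for the fixed `c`. Joint continuity, which fails to make sense of Zariski products, is not
  -- needed.
  obtain ⟨c, hc, hcU, hcV⟩ := hB.2 _ _ (hU.preimage (hf' a)) (hV.preimage (hf' a'))
    ⟨b, hb, hab⟩ ⟨b', hb', hab'⟩
  obtain ⟨d, hd, hdU, hdV⟩ := hA.2 _ _ (hU.preimage (hf c)) (hV.preimage (hf c))
    ⟨a, ha, hcU⟩ ⟨a', ha', hcV⟩
  exact ⟨f d c, Set.mem_image2_of_mem hd hc, hdU, hdV⟩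

/-- Every nonempty collection of irreducible closed subsets of a locally Noetherian scheme has a
maximal element. -/
theorem exists_maximal_irreducibleCloseds {B : Scheme.{u}} [IsLocallyNoetherian B]
    {S : Set (Set B)} (hS : S.Nonempty) (hirr : ∀ Z ∈ S, IsIrreducible Z)
    (hcl : ∀ Z ∈ S, IsClosed Z) : ∃ Z ∈ S, ∀ Z' ∈ S, Z ⊆ Z' → Z' ⊆ Z := by
  obtain ⟨Z₁, hZ₁⟩ := hS
  obtain ⟨η, hη⟩ := QuasiSober.sober (hirr Z₁ hZ₁) (hcl Z₁ hZ₁)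
  -- Irreducible closed sets containing `Z₁` correspond to primes of the local ring at its generic
  -- point, larger sets to smaller primes. Heights there are finite, so a prime of minimal height
  -- gives a maximal set.
  let ι := B.fromSpecStalk η
  let P : Set (Spec (B.presheaf.stalk η)) := {p | closure {ι p} ∈ S}
  have hgen : ∀ Z ∈ S, Z₁ ⊆ Z → ∃ p, closure {ι p} = Z := by
    intro Z hZ h
    obtain ⟨ξ, hξ⟩ := QuasiSober.sober (hirr Z hZ) (hcl Z hZ)
    have : ξ ∈ Set.range ι := by
      rw [Scheme.range_fromSpecStalk]
      exact specializes_iff_mem_closure.2 (hξ.def.symm ▸ h hη.mem)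
    obtain ⟨p, rfl⟩ := this
    exact ⟨p, hξ.def⟩
  have hmem : ∀ p, Z₁ ⊆ closure {ι p} := by
    intro p
    have : ι p ∈ Set.range ι := ⟨p, rfl⟩
    rw [Scheme.range_fromSpecStalk] at this
    rw [← hη.def]
    exact closure_minimal (Set.singleton_subset_iff.2 this.mem_closure) isClosed_closure
  have hP : P.Nonempty := by
    obtain ⟨p, hp⟩ := hgen Z₁ hZ₁ subset_rfl
    exact ⟨p, by simpa [P, hp] using hZ₁⟩
  let h : Spec (B.presheaf.stalk η) → ℕ∞ := fun p => Ideal.height (PrimeSpectrum.asIdeal p)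
  obtain ⟨p, hp, hmin⟩ := (InvImage.wf h wellFounded_lt).has_min P hP
  refine ⟨_, hp, fun Z' hZ' hle => ?_⟩
  obtain ⟨q, rfl⟩ := hgen Z' hZ' ((hmem p).trans hle)
  have hsp : q ⤳ p := by
    rw [← (B.fromSpecStalk η).isEmbedding.isInducing.specializes_iff, specializes_iff_mem_closure]
    exact hle (subset_closure rfl)
  have hqp : PrimeSpectrum.asIdeal q ≤ PrimeSpectrum.asIdeal p :=
    (PrimeSpectrum.le_iff_specializes q p).2 hsp
  have heq : PrimeSpectrum.asIdeal q = PrimeSpectrum.asIdeal p := by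
    by_contra hne
    have := PrimeSpectrum.isPrime q
    have := PrimeSpectrum.isPrime p
    exact hmin q hZ' (Ideal.height_strict_mono_of_isPrime_of_isPrime (lt_of_le_of_ne hqp hne))
  rw [show q = p from PrimeSpectrum.ext heq]

/-! ## The Zariski topology on the points of a variety -/

section Points

variable {k : Type u} [Field k] {A B : Over (Spec (.of k))}

theorem Pt.toPoint_comp (x : Pt A) (f : A ⟶ B) : Pt.toPoint (x ≫ f) = f.left x.toPoint :=
  Scheme.Hom.comp_apply x.left f.left _

theorem Pt.isInducing_toPoint : IsInducing (Pt.toPoint (X := A)) := ⟨rfl⟩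

theorem Pt.continuous_comp (f : A ⟶ B) : Continuous fun x : Pt A => x ≫ f := by
  rw [Pt.isInducing_toPoint.continuous_iff]
  refine (f.left.continuous.comp Pt.isInducing_toPoint.continuous).congr fun x => ?_
  exact (Pt.toPoint_comp x f).symm

theorem Pt.continuous_lift_left (b : Pt B) :
    Continuous fun a : Pt A => (lift a b : Pt (A ⊗ B)) := by
  refine (Pt.continuous_comp (lift (𝟙 A) (toUnit A ≫ b))).congr fun a => ?_
  rw [comp_lift, Category.comp_id, ← Category.assoc, toUnit_unique (a ≫ toUnit A) (𝟙 _)]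
  exact congrArg _ (Category.id_comp b)

theorem Pt.continuous_lift_right (a : Pt A) :
    Continuous fun b : Pt B => (lift a b : Pt (A ⊗ B)) := by
  refine (Pt.continuous_comp (lift (toUnit B ≫ a) (𝟙 B))).congr fun b => ?_
  rw [comp_lift, Category.comp_id, ← Category.assoc, toUnit_unique (b ≫ toUnit B) (𝟙 _)]
  exact congrArg (fun z => lift z b) (Category.id_comp a)

theorem isNoetherian_left [IsVariety A] : AlgebraicGeometry.IsNoetherian A.left :=
  have : CompactSpace A.left := QuasiCompact.compactSpace_of_compactSpace A.hom
  { __ := LocallyOfFiniteType.isLocallyNoetherian A.hom }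

instance Pt.noetherianSpace [IsVariety A] : NoetherianSpace (Pt A) :=
  have : AlgebraicGeometry.IsNoetherian A.left := isNoetherian_left
  Pt.isInducing_toPoint.noetherianSpace

/-- In a nonempty collection of irreducible sets of points there is one that is dense in every
member containing it. -/
theorem Pt.exists_forall_subset_closure [IsVariety B] {S : Set (Set (Pt B))} (hS : S.Nonempty)
    (hirr : ∀ W ∈ S, IsIrreducible W) : ∃ W ∈ S, ∀ W' ∈ S, W ⊆ W' → W' ⊆ closure W := by
  have : AlgebraicGeometry.IsNoetherian B.left := isNoetherian_left
  obtain ⟨_, ⟨W, hW, rfl⟩, hmax⟩ := exists_maximal_irreducibleCloseds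
    (S := (fun W => closure (Pt.toPoint '' W)) '' S) (hS.image _)
    (by
      rintro _ ⟨W, hW, rfl⟩
      exact ((hirr W hW).image _ Pt.isInducing_toPoint.continuous.continuousOn).closure)
    (by
      rintro _ ⟨W, hW, rfl⟩
      exact isClosed_closure)
  refine ⟨W, hW, fun W' hW' hle => ?_⟩
  rw [Pt.isInducing_toPoint.closure_eq_preimage_closure_image]
  exact fun x hx => hmax _ ⟨W', hW', rfl⟩ (closure_mono (Set.image_mono hle))
    (subset_closure ⟨x, hx, rfl⟩)

variable [IsAlgClosed k]

theorem Pt.isClosed_toPoint [IsVariety A] (x : Pt A) : IsClosed {x.toPoint} :=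
  (pointEquivClosedPoint A.hom ⟨x.left, Over.w x⟩).2

theorem Pt.toPoint_injective [IsVariety A] : Function.Injective (Pt.toPoint (X := A)) :=
  fun x y h => Over.OverMorphism.ext (ext_of_apply_closedPoint_eq A.hom (Over.w x) (Over.w y) h)

/-- Nullstellensatz: closed points meet every nonempty locally closed set, and over algebraically
closed `k` they are `k`-points. -/
theorem Pt.exists_toPoint_mem [IsVariety A] {S : Set A.left} (hS : S.Nonempty)
    (hS' : IsLocallyClosed S) : ∃ x : Pt A, x.toPoint ∈ S := by
  have : JacobsonSpace A.left := LocallyOfFiniteType.jacobsonSpace (Y := Spec _) A.hom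
  obtain ⟨a, ha, hc⟩ := nonempty_inter_closedPoints hS hS'
  let p : Pt A := Over.homMk (pointOfClosedPoint A.hom a hc) (pointOfClosedPoint_comp A.hom a hc)
  have hp : p.toPoint = a := pointOfClosedPoint_apply A.hom a hc (IsLocalRing.closedPoint k)
  exact ⟨p, by rwa [hp]⟩

theorem Pt.irreducibleSpace [IsVariety A] [IrreducibleSpace A.left] : IrreducibleSpace (Pt A) := by
  have hne : Nonempty (Pt A) :=
    ⟨(Pt.exists_toPoint_mem Set.univ_nonempty isOpen_univ.isLocallyClosed).choose⟩
  have : PreirreducibleSpace (Pt A) := by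
    refine ⟨?_⟩
    rintro _ _ ⟨U, hU, rfl⟩ ⟨V, hV, rfl⟩ ⟨u, -, hu⟩ ⟨v, -, hv⟩
    obtain ⟨x, hx⟩ := Pt.exists_toPoint_mem
      (nonempty_preirreducible_inter hU hV ⟨_, hu⟩ ⟨_, hv⟩) (hU.inter hV).isLocallyClosed
    exact ⟨x, trivial, hx⟩
  exact ⟨hne⟩

/-- Chevalley's theorem on points: the image of a locally closed set under a morphism, when
irreducible, contains a nonempty open subset of its closure. -/
theorem Pt.exists_isOpen_closure_inter_subset_image [IsVariety A] [IsVariety B] (f : A ⟶ B)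
    {S : Set (Pt A)} (hS : IsLocallyClosed S)
    (hirr : IsIrreducible ((fun x : Pt A => (x ≫ f : Pt B)) '' S)) :
    ∃ V : Set (Pt B), IsOpen V ∧ (((fun x : Pt A => (x ≫ f : Pt B)) '' S) ∩ V).Nonempty ∧
      closure ((fun x : Pt A => (x ≫ f : Pt B)) '' S) ∩ V ⊆
        (fun x : Pt A => (x ≫ f : Pt B)) '' S := by
  have : AlgebraicGeometry.IsNoetherian A.left := isNoetherian_left
  have : AlgebraicGeometry.IsNoetherian B.left := isNoetherian_left
  set W := (fun x : Pt A => (x ≫ f : Pt B)) '' S with hW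
  obtain ⟨_, _, ⟨U, hU, rfl⟩, hC', rfl⟩ := hS
  obtain ⟨C, hC, rfl⟩ := Pt.isInducing_toPoint.isClosed_iff.1 hC'
  have hlf : LocallyOfFiniteType f.left := by
    have : LocallyOfFiniteType (f.left ≫ B.hom) := by rw [Over.w]; infer_instance
    exact locallyOfFiniteType_of_comp f.left B.hom
  have hfp : LocallyOfFinitePresentation f.left :=
    LocallyOfFinitePresentation.iff_locallyOfFiniteType.2 hlf
  have hcons : IsConstructible (U ∩ C) :=
    ((NoetherianSpace.isCompact U).isConstructible hU).inter
      (isConstructible_compl.1 ((NoetherianSpace.isCompact Cᶜ).isConstructible hC.isOpen_compl))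
  have himg := f.left.isConstructible_image hcons
  -- The scheme-theoretic image has no extra `k`-points: the fibre over a `k`-point is closed, so if
  -- it meets `U ∩ C` it does so in a `k`-point.
  have hsub : ∀ w : Pt B, w.toPoint ∈ f.left '' (U ∩ C) ↔ w ∈ W := by
    intro w
    constructor
    · rintro ⟨a, ha, haw⟩
      obtain ⟨x, hx, hxw⟩ := Pt.exists_toPoint_mem (S := (U ∩ C) ∩ f.left ⁻¹' {w.toPoint})
        ⟨a, ha, haw⟩ ((hU.isLocallyClosed.inter hC.isLocallyClosed).inter
          ((Pt.isClosed_toPoint w).preimage f.left.continuous).isLocallyClosed)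
      exact ⟨x, hx, Pt.toPoint_injective ((Pt.toPoint_comp x f).trans hxw)⟩
    · rintro ⟨x, hx, rfl⟩
      exact ⟨x.toPoint, hx, (Pt.toPoint_comp x f).symm⟩
  obtain ⟨V, hV, hne, hVs⟩ := exists_isOpen_inter_subset_or_subset_compl himg
    (hirr.image _ Pt.isInducing_toPoint.continuous.continuousOn).closure
  obtain ⟨z, hz, hzV⟩ := hne
  obtain ⟨_, hwV, w, hw, rfl⟩ := mem_closure_iff.1 hz V hV hzV
  refine ⟨Pt.toPoint ⁻¹' V, hV.preimage Pt.isInducing_toPoint.continuous, ⟨w, hw, hwV⟩, ?_⟩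
  rcases hVs with hVs | hVs
  · rintro x ⟨hx, hxV⟩
    rw [Pt.isInducing_toPoint.closure_eq_preimage_closure_image] at hx
    exact (hsub x).1 (hVs ⟨hx, hxV⟩)
  · exact absurd ((hsub w).2 hw) (hVs ⟨subset_closure ⟨w, hw, rfl⟩, hwV⟩)

end Points

end AutFamilies

namespace AutFamilies

open scoped Pointwise

namespace Family

/-! ## Products of sequences of families -/

section Products

variable {k : Type u} [Field k] {X : Over (Spec (.of k))}

/-- The members of `I` together with their inverses. -/
def withInverses (I : Set (Family X)) : Set (Family X) := {H | H ∈ I ∨ ∃ H' ∈ I, H = H'.inverse}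

theorem withInverses_nonempty {I : Set (Family X)} (hI : I.Nonempty) : (withInverses I).Nonempty :=
  hI.imp fun _ hF => Or.inl hF

theorem isUnital_of_mem_withInverses {I : Set (Family X)} (hI : ∀ F ∈ I, F.IsUnital) :
    ∀ F ∈ withInverses I, F.IsUnital := by
  rintro F (hF | ⟨F, hF, rfl⟩)
  · exact hI F hF
  · obtain ⟨t, ht⟩ := hI F hF
    exact ⟨t, inv_eq_one.2 ht⟩

/-- Lets group elements be reached by products alone, once inverse families are admitted. -/
theorem closure_withInverses (I : Set (Family X)) :
    Submonoid.closure (⋃ H ∈ withInverses I, Set.range H.φ) =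
      (generatedGroup I).toSubmonoid := by
  rw [generatedGroup, Subgroup.closure_toSubmonoid]
  congr 1
  ext g
  simp only [withInverses, Set.mem_ofPred_eq, Set.mem_iUnion, Set.mem_union, Set.mem_inv]
  constructor
  · rintro ⟨F, hF | ⟨F, hF, rfl⟩, t, rfl⟩
    · exact Or.inl ⟨F, hF, t, rfl⟩
    · exact Or.inr ⟨F, hF, t, (inv_inv _).symm⟩
  · rintro (⟨F, hF, t, rfl⟩ | ⟨F, hF, t, ht⟩)
    · exact ⟨F, Or.inl hF, t, rfl⟩
    · exact ⟨F.inverse, Or.inr ⟨F, hF, rfl⟩, t, inv_eq_iff_eq_inv.2 ht⟩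

variable [IsAlgClosed k]

theorem range_prod (F F' : Family X) :
    Set.range (F.prod F').φ = Set.range F.φ * Set.range F'.φ := by
  ext g
  rw [Set.mem_mul]
  constructor
  · rintro ⟨p, rfl⟩
    exact ⟨_, ⟨p ≫ fst _ _, rfl⟩, _, ⟨p ≫ snd _ _, rfl⟩, rfl⟩
  · rintro ⟨_, ⟨t, rfl⟩, _, ⟨s, rfl⟩, rfl⟩
    refine ⟨lift t s, ?_⟩
    change F.φ (lift t s ≫ fst _ _) * F'.φ (lift t s ≫ snd _ _) = _
    rw [lift_fst, lift_snd]

/-- Iterated products are bracketed to the right, so the two parameter varieties differ by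
reassociation; comparing only the sets of automorphisms avoids this. -/
theorem range_seqProd_append (F F' : Family X) (l l' : List (Family X)) :
    Set.range (seqProd F (l ++ F' :: l')).φ =
      Set.range (seqProd F l).φ * Set.range (seqProd F' l').φ := by
  induction l generalizing F with
  | nil => exact range_prod _ _
  | cons H l ih =>
    change Set.range (F.prod (seqProd H (l ++ F' :: l'))).φ =
      Set.range (F.prod (seqProd H l)).φ * _
    rw [range_prod, range_prod, ih, mul_assoc]

theorem IsAlgebraic.prod {F F' : Family X} (hF : F.IsAlgebraic) (hF' : F'.IsAlgebraic) :
    (F.prod F').IsAlgebraic := by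
  obtain ⟨Φ, hΦ⟩ := hF
  obtain ⟨Ψ, hΨ⟩ := hF'
  -- The action map is `(t, s, x) ↦ (t, ψ_s(x)) ↦ φ_t(ψ_s(x))`.
  have key (p : Pt (F.T ⊗ F'.T)) (x : Pt X) :
      lift p x ≫ (α_ F.T F'.T X).hom ≫ F.T ◁ Ψ ≫ Φ =
        (F.φ (p ≫ fst _ _) * F'.φ (p ≫ snd _ _)) • x := by
    rw [mul_smul, ← hΨ, ← hΦ, ← Category.assoc, ← Category.assoc]
    congr 1
    ext1
    · simp
    · rw [lift_snd, Category.assoc, Category.assoc, whiskerLeft_snd, ← Category.assoc,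
        ← Category.assoc]
      congr 1
      ext1 <;> simp
  exact ⟨(α_ F.T F'.T X).hom ≫ F.T ◁ Ψ ≫ Φ, key⟩

/-- The families that are products of nonempty finite sequences of members of `J`. -/
def IsProductOf (J : Set (Family X)) (F : Family X) : Prop :=
  ∃ (F₀ : Family X) (l : List (Family X)), (∀ H ∈ F₀ :: l, H ∈ J) ∧ F = seqProd F₀ l

theorem IsProductOf.exists_range_eq_mul {J : Set (Family X)} {F F' : Family X}
    (hF : IsProductOf J F) (hF' : IsProductOf J F') :
    ∃ F'', IsProductOf J F'' ∧ Set.range F''.φ = Set.range F.φ * Set.range F'.φ := by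
  obtain ⟨F₀, l, hl, rfl⟩ := hF
  obtain ⟨F₀', l', hl', rfl⟩ := hF'
  refine ⟨_, ⟨F₀, l ++ F₀' :: l', fun H hH => ?_, rfl⟩, range_seqProd_append _ _ _ _⟩
  rw [← List.cons_append, List.mem_append] at hH
  exact hH.elim (hl H) (hl' H)

theorem isProductOf_of_mem {J : Set (Family X)} {F : Family X} (hF : F ∈ J) : IsProductOf J F :=
  ⟨F, [], by simpa using hF, rfl⟩

theorem IsProductOf.induction {J : Set (Family X)} {P : Family X → Prop} (mem : ∀ F ∈ J, P F)
    (prod : ∀ F ∈ J, ∀ F', P F' → P (F.prod F')) {F : Family X} (hF : IsProductOf J F) : P F := by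
  obtain ⟨F₀, l, hl, rfl⟩ := hF
  induction l generalizing F₀ with
  | nil => exact mem F₀ (hl F₀ (by simp))
  | cons H l ih =>
    exact prod _ (hl _ (by simp)) _ (ih H fun H' hH' => hl _ (List.mem_cons_of_mem _ hH'))

theorem IsProductOf.isAlgebraic {J : Set (Family X)} (hJ : ∀ F ∈ J, F.IsAlgebraic)
    {F : Family X} (hF : IsProductOf J F) : F.IsAlgebraic :=
  hF.induction hJ fun _ hF _ hF' => (hJ _ hF).prod hF'

theorem IsProductOf.isUnital {J : Set (Family X)} (hJ : ∀ F ∈ J, F.IsUnital)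
    {F : Family X} (hF : IsProductOf J F) : F.IsUnital :=
  hF.induction hJ fun F hF F' hF' => by
    rw [IsUnital, range_prod]
    exact Set.mem_mul.2 ⟨1, hJ F hF, 1, hF', one_mul 1⟩

theorem IsProductOf.range_subset {J : Set (Family X)} {F : Family X} (hF : IsProductOf J F) :
    Set.range F.φ ⊆ Submonoid.closure (⋃ H ∈ J, Set.range H.φ) := by
  have hJ : ∀ H ∈ J, Set.range H.φ ⊆ Submonoid.closure (⋃ H ∈ J, Set.range H.φ) :=
    fun H hH => (Set.subset_biUnion_of_mem (u := fun H : Family X => Set.range H.φ) hH).trans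
      Submonoid.subset_closure
  refine hF.induction hJ fun F hF F' hF' => ?_
  rw [range_prod]
  rintro _ ⟨g, hg, h, hh, rfl⟩
  exact mul_mem (hJ F hF hg) (hF' hh)

theorem exists_isProductOf_mem {J : Set (Family X)} (hne : J.Nonempty)
    (hJ : ∀ F ∈ J, F.IsUnital) {g : Aut X}
    (hg : g ∈ Submonoid.closure (⋃ H ∈ J, Set.range H.φ)) :
    ∃ F, IsProductOf J F ∧ g ∈ Set.range F.φ := by
  induction hg using Submonoid.closure_induction with
  | mem g hg =>
    simp only [Set.mem_iUnion] at hg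
    obtain ⟨F, hF, hg⟩ := hg
    exact ⟨F, isProductOf_of_mem hF, hg⟩
  | one =>
    obtain ⟨F, hF⟩ := hne
    exact ⟨F, isProductOf_of_mem hF, hJ F hF⟩
  | mul g h _ _ hg hh =>
    obtain ⟨F, hF, hg⟩ := hg
    obtain ⟨F', hF', hh⟩ := hh
    obtain ⟨F'', hF'', h⟩ := hF.exists_range_eq_mul hF'
    exact ⟨F'', hF'', h ▸ Set.mul_mem_mul hg hh⟩

/-- Multiplying unital families loses no element, so the families reaching the individual elements
can be multiplied together. -/
theorem exists_isProductOf_subset {J : Set (Family X)} (hne : J.Nonempty)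
    (hJ : ∀ F ∈ J, F.IsUnital) {s : Set (Aut X)} (hs : s.Finite)
    (hsJ : s ⊆ Submonoid.closure (⋃ H ∈ J, Set.range H.φ)) :
    ∃ F, IsProductOf J F ∧ s ⊆ Set.range F.φ := by
  induction s, hs using Set.Finite.induction_on with
  | empty =>
    obtain ⟨F, hF⟩ := hne
    exact ⟨F, isProductOf_of_mem hF, Set.empty_subset _⟩
  | @insert g s _ _ ih =>
    rw [Set.insert_subset_iff] at hsJ
    obtain ⟨F, hF, hg⟩ := exists_isProductOf_mem hne hJ hsJ.1
    obtain ⟨F', hF', hs⟩ := ih hsJ.2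
    obtain ⟨F'', hF'', h⟩ := hF.exists_range_eq_mul hF'
    refine ⟨F'', hF'', h ▸ Set.insert_subset ?_ fun x hx => ?_⟩
    · simpa using Set.mul_mem_mul hg (hF'.isUnital hJ)
    · simpa using Set.mul_mem_mul (hF.isUnital hJ) (hs hx)

end Products

end Family

end AutFamilies

namespace AutFamilies

open TopologicalSpace
open scoped Pointwise

namespace Family

/-! ## Exhaustive families -/

section Exhaustive

variable {k : Type u} [Field k] {X : Over (Spec (.of k))}

/-- The homeomorphism `(x, y) ↦ (x, g(y))` of the points of `X × X`. -/
noncomputable def actSnd (g : Aut X) : Pt (X ⊗ X) ≃ₜ Pt (X ⊗ X) where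
  toFun p := p ≫ X ◁ g.hom
  invFun p := p ≫ X ◁ g.inv
  left_inv p := by
    change (p ≫ X ◁ g.hom) ≫ X ◁ g.inv = p
    rw [Category.assoc, ← MonoidalCategory.whiskerLeft_comp, g.hom_inv_id,
      MonoidalCategory.whiskerLeft_id, Category.comp_id]
  right_inv p := by
    change (p ≫ X ◁ g.inv) ≫ X ◁ g.hom = p
    rw [Category.assoc, ← MonoidalCategory.whiskerLeft_comp, g.inv_hom_id,
      MonoidalCategory.whiskerLeft_id, Category.comp_id]
  continuous_toFun := Pt.continuous_comp _
  continuous_invFun := Pt.continuous_comp _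

theorem actSnd_lift (g : Aut X) (x y : Pt X) : actSnd g (lift x y) = lift x (g • y) :=
  lift_whiskerLeft x y g.hom

theorem actSnd_one (p : Pt (X ⊗ X)) : actSnd 1 p = p := by
  change p ≫ X ◁ 𝟙 X = p
  rw [MonoidalCategory.whiskerLeft_id, Category.comp_id]

theorem actSnd_mul (g h : Aut X) (p : Pt (X ⊗ X)) : actSnd (g * h) p = actSnd g (actSnd h p) := by
  change p ≫ X ◁ (h.hom ≫ g.hom) = (p ≫ X ◁ h.hom) ≫ X ◁ g.hom
  rw [MonoidalCategory.whiskerLeft_comp, Category.assoc]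

theorem continuous_lift_smul (g : Aut X) :
    Continuous fun x : Pt X => (lift x (g • x) : Pt (X ⊗ X)) := by
  refine (Pt.continuous_comp (lift (𝟙 X) g.hom)).congr fun x => ?_
  rw [comp_lift, Category.comp_id]
  rfl

/-- The set of pairs `(x, φ_t(x))` with `x ∈ U` and `t ∈ T`. -/
def graphOn (U : Set (Pt X)) (F : Family X) : Set (Pt (X ⊗ X)) :=
  {p | ∃ x ∈ U, ∃ g ∈ Set.range F.φ, p = lift x (g • x)}

theorem graphOn_mono {U : Set (Pt X)} {F F' : Family X} (h : Set.range F.φ ⊆ Set.range F'.φ) :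
    graphOn U F ⊆ graphOn U F' := by
  rintro _ ⟨x, hx, g, hg, rfl⟩
  exact ⟨x, hx, g, h hg, rfl⟩

/-- Puts the graph in the form required by Chevalley's theorem. -/
theorem graphOn_eq_image {U : Set (Pt X)} {F : Family X} {Φ : F.T ⊗ X ⟶ X}
    (hΦ : ∀ (t : Pt F.T) (x : Pt X), lift t x ≫ Φ = F.φ t • x) :
    graphOn U F = (fun p : Pt (F.T ⊗ X) => (p ≫ lift (snd F.T X) Φ : Pt (X ⊗ X))) ''
      ((fun p : Pt (F.T ⊗ X) => (p ≫ snd F.T X : Pt X)) ⁻¹' U) := by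
  ext q
  constructor
  · rintro ⟨x, hx, _, ⟨t, rfl⟩, rfl⟩
    refine ⟨lift t x, ?_, ?_⟩
    · simpa using hx
    · change lift t x ≫ _ = _
      rw [comp_lift, lift_snd, hΦ]
  · rintro ⟨p, hp, rfl⟩
    refine ⟨p ≫ snd _ _, hp, _, ⟨p ≫ fst _ _, rfl⟩, ?_⟩
    change p ≫ _ = _
    rw [comp_lift, ← hΦ, lift_comp_fst_snd]

variable [IsAlgClosed k]

theorem isIrreducible_graphOn [IsVariety X] {U : Set (Pt X)} (hU : IsIrreducible U)
    {F : Family X} (hF : F.IsAlgebraic) : IsIrreducible (graphOn U F) := by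
  obtain ⟨Φ, hΦ⟩ := hF
  have := F.isVariety
  have := F.irreducible
  have : IrreducibleSpace (Pt F.T) := Pt.irreducibleSpace
  have key := isIrreducible_image2_of_separately_continuous
    (IrreducibleSpace.isIrreducible_univ (Pt F.T)) hU
    (fun t x => (lift x (F.φ t • x) : Pt (X ⊗ X)))
    (fun x => by
      simp_rw [← hΦ]
      exact (Pt.continuous_lift_right x).comp
        ((Pt.continuous_comp Φ).comp (Pt.continuous_lift_left x)))
    (fun t => continuous_lift_smul _)
  convert key using 1
  ext q
  constructor
  · rintro ⟨x, hx, _, ⟨t, rfl⟩, rfl⟩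
    exact ⟨t, trivial, x, hx, rfl⟩
  · rintro ⟨t, -, x, hx, rfl⟩
    exact ⟨x, hx, _, ⟨t, rfl⟩, rfl⟩

/-- There is a family derived from `I` that exhausts the orbits of the points of `Y` in some
nonempty open part of `Y`. -/
theorem exists_exhausting_on_open [IsVariety X] {I : Set (Family X)} (hne : I.Nonempty)
    (hI : ∀ F ∈ I, F.IsUnital ∧ F.IsAlgebraic) {Y : Set (Pt X)} (hY : IsLocallyClosed Y)
    (hYne : Y.Nonempty) :
    ∃ V : Set (Pt X), IsOpen V ∧ (Y ∩ V).Nonempty ∧ ∃ F, IsProductOf (withInverses I) F ∧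
      ∀ y ∈ Y ∩ V, ∀ g ∈ generatedGroup I, ∃ s ∈ Set.range F.φ, s • y = g • y := by
  have hXX : IsVariety (X ⊗ X) := isVariety_tensorObj ‹_› ‹_›
  have hIu : ∀ F ∈ I, F.IsUnital := fun F hF => (hI F hF).1
  have hIu' := isUnital_of_mem_withInverses hIu
  obtain ⟨V₀, hV₀, hU⟩ := exists_isOpen_isIrreducible_inter hYne
  set U := Y ∩ V₀ with hUdef
  have hUlc : IsLocallyClosed U := hY.inter hV₀.isLocallyClosed
  -- Only members of `I` are multiplied here, since inverse families are not assumed algebraic.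
  have hirr : ∀ F, IsProductOf I F → IsIrreducible (graphOn U F) := fun F hF =>
    isIrreducible_graphOn hU (hF.isAlgebraic fun F hF => (hI F hF).2)
  obtain ⟨_, ⟨F₀, hF₀, rfl⟩, hmax⟩ := Pt.exists_forall_subset_closure
    (S := graphOn U '' {F | IsProductOf I F})
    (by
      obtain ⟨F, hF⟩ := hne
      exact ⟨_, F, isProductOf_of_mem hF, rfl⟩)
    (by
      rintro _ ⟨F, hF, rfl⟩
      exact hirr F hF)
  set Z := closure (graphOn U F₀) with hZ
  have hle : ∀ F, IsProductOf I F → graphOn U F ⊆ Z := by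
    intro F hF
    obtain ⟨F', hF', h⟩ := hF.exists_range_eq_mul hF₀
    refine (graphOn_mono ?_).trans (hmax _ ⟨F', hF', rfl⟩ (graphOn_mono ?_))
    · exact fun g hg => h ▸ by simpa using Set.mul_mem_mul hg (hF₀.isUnital hIu)
    · exact fun g hg => h ▸ by simpa using Set.mul_mem_mul (hF.isUnital hIu) hg
  -- For a generator `g` in a family `F`, the graph of `F₀` is carried into that of `F · F₀`, hence
  -- into `Z`. Equality of `Z` with its preimage then handles inverses.
  have hstab : ∀ g ∈ generatedGroup I, actSnd g ⁻¹' Z = Z := by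
    intro g hg
    induction hg using Subgroup.closure_induction with
    | mem g hg =>
      simp only [Set.mem_iUnion] at hg
      obtain ⟨F, hF, hg⟩ := hg
      obtain ⟨F', hF', h⟩ := (isProductOf_of_mem hF).exists_range_eq_mul hF₀
      refine preimage_eq_of_mapsTo _ isClosed_closure ?_
      refine (Set.MapsTo.closure (t := Z) ?_ (actSnd g).continuous).mono_right
        isClosed_closure.closure_eq.le
      rintro _ ⟨x, hx, g', hg', rfl⟩
      refine hle F' hF' ⟨x, hx, g * g', h ▸ Set.mul_mem_mul hg hg', ?_⟩
      rw [actSnd_lift, mul_smul]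
    | one =>
      ext p
      rw [Set.mem_preimage, actSnd_one]
    | mul g h _ _ hg hh =>
      ext p
      rw [Set.mem_preimage, actSnd_mul, ← Set.mem_preimage, hg, ← Set.mem_preimage, hh]
    | inv g _ hg =>
      ext p
      rw [Set.mem_preimage, ← hg, Set.mem_preimage, ← actSnd_mul, mul_inv_cancel, actSnd_one, hg]
  have hmem : ∀ x ∈ U, ∀ g ∈ generatedGroup I, lift x (g • x) ∈ Z := by
    intro x hx g hg
    have h1 : lift x ((1 : Aut X) • x) ∈ Z :=
      hle F₀ hF₀ ⟨x, hx, 1, hF₀.isUnital hIu, rfl⟩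
    rw [← hstab g hg, Set.mem_preimage, actSnd_lift, one_smul] at h1
    exact h1
  obtain ⟨V, hV, hVne, hVsub⟩ :
      ∃ V, IsOpen V ∧ (graphOn U F₀ ∩ V).Nonempty ∧ Z ∩ V ⊆ graphOn U F₀ := by
    have hirr₀ := hirr F₀ hF₀
    obtain ⟨Φ, hΦ⟩ := hF₀.isAlgebraic fun F hF => (hI F hF).2
    have := F₀.isVariety
    have : IsVariety (F₀.T ⊗ X) := isVariety_tensorObj F₀.isVariety ‹_›
    rw [hZ, graphOn_eq_image hΦ]
    rw [graphOn_eq_image hΦ] at hirr₀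
    exact Pt.exists_isOpen_closure_inter_subset_image _
      (hUlc.preimage (Pt.continuous_comp _)) hirr₀
  obtain ⟨_, ⟨x₀, hx₀, g₀, hg₀, rfl⟩, hx₀V⟩ := hVne
  have hsub : ∀ F, IsProductOf I F → Set.range F.φ ⊆ generatedGroup I := fun F hF =>
    hF.range_subset.trans (Subgroup.le_closure_toSubmonoid _)
  obtain ⟨t, ht⟩ := (NoetherianSpace.isCompact
    (⋃ g : generatedGroup I, actSnd g.1 ⁻¹' V)).elim_finite_subcover
    (fun g : generatedGroup I => actSnd g.1 ⁻¹' V)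
    (fun g => hV.preimage (actSnd g.1).continuous) subset_rfl
  -- The inverses are collected because `h g(y) = g₁(y)` will be solved as `g(y) = h⁻¹ g₁(y)`.
  obtain ⟨H, hH, htH⟩ := exists_isProductOf_subset (withInverses_nonempty hne) hIu'
    (s := (fun g : generatedGroup I => (g.1)⁻¹) '' t) (t.finite_toSet.image _) (by
      rw [closure_withInverses]
      rintro _ ⟨g, -, rfl⟩
      exact (generatedGroup I).inv_mem g.2)
  have hF₀' : IsProductOf (withInverses I) F₀ := by
    obtain ⟨F₁, l, hl, rfl⟩ := hF₀
    exact ⟨F₁, l, fun H hH => Or.inl (hl H hH), rfl⟩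
  obtain ⟨F, hF, hFr⟩ := hH.exists_range_eq_mul hF₀'
  -- For `y` with `(y, g₀(y)) ∈ V`, every `(y, g(y))` is moved into `V` by `g₀ g⁻¹`, so it lies in
  -- one of the finitely many chosen translates.
  refine ⟨V₀ ∩ {x | lift x (g₀ • x) ∈ V}, hV₀.inter (hV.preimage (continuous_lift_smul g₀)),
    ⟨x₀, hx₀.1, hx₀.2, hx₀V⟩, F, hF, ?_⟩
  rintro y ⟨hyY, hyV₀, hyV⟩ g hg
  have hyU : y ∈ U := ⟨hyY, hyV₀⟩
  have hcov : lift y (g • y) ∈ ⋃ g : generatedGroup I, actSnd g.1 ⁻¹' V := by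
    refine Set.mem_iUnion.2 ⟨⟨g₀ * g⁻¹, mul_mem (hsub F₀ hF₀ hg₀) (inv_mem hg)⟩, ?_⟩
    rw [Set.mem_preimage, actSnd_lift, mul_smul, inv_smul_smul]
    exact hyV
  obtain ⟨h, hht, hh⟩ := Set.mem_iUnion₂.1 (ht hcov)
  rw [Set.mem_preimage, actSnd_lift, ← mul_smul] at hh
  obtain ⟨x, -, g₁, hg₁, heq⟩ := hVsub ⟨hmem y hyU _ (mul_mem h.2 hg), hh⟩
  have hyx : y = x := by simpa using congrArg (fun p : Pt (X ⊗ X) => p ≫ fst X X) heq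
  have hgx : (h.1 * g) • y = g₁ • x := by
    simpa using congrArg (fun p : Pt (X ⊗ X) => p ≫ snd X X) heq
  refine ⟨h.1⁻¹ * g₁, hFr ▸ Set.mul_mem_mul (htH ⟨h, hht, rfl⟩) hg₁, ?_⟩
  rw [mul_smul, hyx, ← hgx, hyx, mul_smul, inv_smul_smul]

/-- A family derived from `I` exhausts the orbits of the points of an invariant locally closed
set. -/
theorem exists_exhausting [IsVariety X] {I : Set (Family X)} (hne : I.Nonempty)
    (hI : ∀ F ∈ I, F.IsUnital ∧ F.IsAlgebraic) {Y : Set (Pt X)} (hY : IsLocallyClosed Y)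
    (hYG : ∀ g ∈ generatedGroup I, ∀ y ∈ Y, g • y ∈ Y) (C : Closeds (Pt X))
    (hC : ∀ g ∈ generatedGroup I, ∀ y ∈ Y ∩ C, g • y ∈ C) :
    ∃ F, IsProductOf (withInverses I) F ∧
      ∀ y ∈ Y ∩ C, ∀ g ∈ generatedGroup I, ∃ s ∈ Set.range F.φ, s • y = g • y := by
  have hIu' := isUnital_of_mem_withInverses fun F hF => (hI F hF).1
  have hne' : (withInverses I).Nonempty := withInverses_nonempty hne
  -- Noetherian induction over closed `C` for which `Y ∩ C` is invariant.
  induction C using WellFoundedLT.induction with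
  | ind C ih =>
  rcases (Y ∩ C).eq_empty_or_nonempty with hemp | hYne
  · obtain ⟨F, hF⟩ := hne'
    exact ⟨F, isProductOf_of_mem hF, by simp [hemp]⟩
  obtain ⟨V, hV, ⟨y₀, hy₀, hy₀V⟩, F, hF, hFV⟩ :=
    exists_exhausting_on_open hne hI (hY.inter C.isClosed.isLocallyClosed) hYne
  have hVg : ∀ g : generatedGroup I, IsOpen {y : Pt X | g.1 • y ∈ V} := fun g =>
    hV.preimage (Pt.continuous_comp g.1.hom)
  -- `N` is the saturation of `V` under `G`, so removing it from `C` preserves invariance; finitely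
  -- many translates already cover it.
  set N : Set (Pt X) := ⋃ g : generatedGroup I, {y : Pt X | g.1 • y ∈ V} with hN
  have hNo : IsOpen N := isOpen_iUnion hVg
  obtain ⟨t, ht⟩ := (NoetherianSpace.isCompact N).elim_finite_subcover _ hVg subset_rfl
  let C' : Closeds (Pt X) := ⟨C ∩ Nᶜ, C.isClosed.inter hNo.isClosed_compl⟩
  have hlt : C' < C := by
    refine lt_of_le_of_ne (fun x hx => hx.1) fun h => ?_
    have : y₀ ∈ C' := h ▸ hy₀.2
    exact this.2 (Set.mem_iUnion.2 ⟨1, by simpa using hy₀V⟩)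
  obtain ⟨F', hF', hFC'⟩ := ih C' hlt fun g hg y hy => by
    refine ⟨hC g hg y ⟨hy.1, hy.2.1⟩, fun hgy => hy.2.2 ?_⟩
    obtain ⟨h, hh⟩ := Set.mem_iUnion.1 hgy
    exact Set.mem_iUnion.2 ⟨h * ⟨g, hg⟩, by simpa [mul_smul] using hh⟩
  obtain ⟨H, hH, htH⟩ := exists_isProductOf_subset hne' hIu'
    (s := (↑) '' (t : Set (generatedGroup I))) (t.finite_toSet.image _) (by
      rw [closure_withInverses]
      rintro _ ⟨g, -, rfl⟩
      exact g.2)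
  -- In `F · H · F'`, a point of `N` is moved into `V` by `H` and then treated by `F`, with the
  -- identity from `F'`; a point off `N` is treated by `F'`, with the identity from `F · H`.
  obtain ⟨F₁, hF₁, hr₁⟩ := hF.exists_range_eq_mul hH
  obtain ⟨F₂, hF₂, hr₂⟩ := hF₁.exists_range_eq_mul hF'
  refine ⟨F₂, hF₂, fun y hy g hg => ?_⟩
  by_cases hyN : y ∈ N
  · obtain ⟨h, hht, hh⟩ := Set.mem_iUnion₂.1 (ht hyN)
    obtain ⟨s, hs, hsy⟩ := hFV (h.1 • y) ⟨⟨hYG _ h.2 _ hy.1, hC _ h.2 _ hy⟩, hh⟩ (g * h.1⁻¹)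
      (mul_mem hg (inv_mem h.2))
    refine ⟨s * h.1 * 1, ?_, ?_⟩
    · rw [hr₂, hr₁]
      exact Set.mul_mem_mul (Set.mul_mem_mul hs (htH ⟨h, hht, rfl⟩)) (hF'.isUnital hIu')
    · rw [mul_one, mul_smul, hsy, mul_smul, inv_smul_smul]
  · obtain ⟨s, hs, hsy⟩ := hFC' y ⟨hy.1, hy.2, hyN⟩ g hg
    refine ⟨1 * s, ?_, by rwa [one_mul]⟩
    rw [hr₂]
    exact Set.mul_mem_mul (hF₁.isUnital hIu') hs

end Exhaustive

end Family

end AutFamilies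

/-! ### Existence of an exhaustive derived family -/

theorem mainTheorem1 {k : Type u} [Field k] [IsAlgClosed k]
    (X : Over (Spec (.of k))) [AutFamilies.IsVariety X] [IrreducibleSpace X.left]
    (I : Set (AutFamilies.Family X)) (hne : I.Nonempty)
    (hI : ∀ F ∈ I, F.IsUnital ∧ F.IsAlgebraic)
    (G : Subgroup (Aut X)) (hG : G = AutFamilies.Family.generatedGroup I)
    (Y : Set (AutFamilies.Pt X)) (hY : IsLocallyClosed Y)
    (hYG : ∀ g ∈ G, ∀ y ∈ Y, g • y ∈ Y) :
    ∃ F : AutFamilies.Family X, F.IsDerivedFrom I ∧ F.IsExhaustive G Y := by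
  subst hG
  obtain ⟨F, hF, hex⟩ := AutFamilies.Family.exists_exhausting hne hI hY hYG ⊤ fun _ _ _ _ => trivial
  have hFG : ∀ t, F.φ t ∈ AutFamilies.Family.generatedGroup I := fun t => by
    have := hF.range_subset ⟨t, rfl⟩
    rwa [AutFamilies.Family.closure_withInverses] at this
  -- `IsProductOf (withInverses I) F` unfolds to `F.IsDerivedFrom I`.
  refine ⟨F, hF, hFG, fun y hy => Set.Subset.antisymm ?_ ?_⟩
  · rintro _ ⟨g, rfl⟩
    exact hex y ⟨hy, trivial⟩ g.1 g.2
  · rintro _ ⟨_, ⟨t, rfl⟩, rfl⟩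
    exact ⟨⟨F.φ t, hFG t⟩, rfl⟩
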